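/- All monoids are abelian and written additively. For elements $x,y$ of an abelian monoid $M$ write $x\le y$ if $x+z=y$ for some $z\in M$. An idempotent of $M$ is an element $e\in M$ with $e+e=e$. For an idempotent $e$ let $M_e=\{x\in M : e\le x\le e\}$; this is an abelian group under the addition of $M$, with zero element $e$, and for idempotents $e\le f$ the rule $x\mapsto x+f$ defines a group homomorphism $M_e\to M_f$. For a positive integer $n$ let $(\mathbb Z/n\mathbb Z)\sqcup\{0\}$ be the monoid obtained from the group $\mathbb Z/n\mathbb Z$ by adjoining a new zero element. Theorem 5.3. An abelian monoid $M$ is (isomorphic to) a direct limit, over a nonempty directed partially ordered set, of finite direct sums of monoids of the form $(\mathbb Z/n\mathbb Z)\sqcup\{0\}$ (with positive integers $n$, which may vary among the summands) if and only if the following two conditions hold. (a) $M$ is a strongly periodic conical refinement monoid, that is: for every $x\in M$ there is a positive integer $m$ with $(m+1)x=x$ (equivalently, the subsemigroup generated by $x$ is a finite group); for all $x,y\in M$, $x+y=0$ implies $x=y=0$; and whenever $x_1+x_2=y_1+y_2$ in $M$, there are $z_{11},z_{12},z_{21},z_{22}\in M$ with $x_i=z_{i1}+z_{i2}$ and $y_j=z_{1j}+z_{2j}$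 for $i,j\in\{1,2\}$. (b) For all idempotents $e\le f$ in $M$, the homomorphism $M_e\to M_f$, $x\mapsto x+f$, is injective, and its image $M_e+f$ is a pure subgroup of $M_f$, that is, for every positive integer $n$ and every $y\in M_f$ with $ny\in M_e+f$ there is $z\in M_e+f$ with $nz=ny$. -/

import Mathlib

universe u v w

namespace LimitsOfCyclicMonoids

/-- The algebraic preorder of an abelian monoid: `x ≤ y` iff `x + z = y` for some `z`. -/
def AlgLE {M : Type u} [AddCommMonoid M] (x y : M) : Prop :=
  ∃ z : M, x + z = y

/-- `x + y = 0` always implies `x = y = 0`. -/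
def IsConical (M : Type u) [AddCommMonoid M] : Prop :=
  ∀ x y : M, x + y = 0 → x = 0 ∧ y = 0

/-- The Riesz refinement property. -/
def IsRefinementMonoid (M : Type u) [AddCommMonoid M] : Prop :=
  ∀ x₁ x₂ y₁ y₂ : M, x₁ + x₂ = y₁ + y₂ →
    ∃ z₁₁ z₁₂ z₂₁ z₂₂ : M,
      x₁ = z₁₁ + z₁₂ ∧ x₂ = z₂₁ + z₂₂ ∧ y₁ = z₁₁ + z₂₁ ∧ y₂ = z₁₂ + z₂₂

/-- Every element `x` is strongly periodic: the subsemigroup generated by `x` is a finite group,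
that is, `(m + 1) x = x` for some positive integer `m`. -/
def IsStronglyPeriodic (M : Type u) [AddCommMonoid M] : Prop :=
  ∀ x : M, ∃ m : ℕ, 0 < m ∧ (m + 1) • x = x

/-- The idempotents of `M`, i.e. the elements `e` with `2e = e`. -/
abbrev Idem (M : Type u) [AddCommMonoid M] : Type u :=
  {e : M // e + e = e}

/-- For an idempotent `e`, the set `M_e` of all `x` with `e ≤ x ≤ e`. -/
def Component {M : Type u} [AddCommMonoid M] (e : Idem M) : Type u :=
  {x : M // AlgLE e.1 x ∧ AlgLE x e.1}

namespace Component

variable {M : Type u} [AddCommMonoid M]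

theorem idem_add {e : Idem M} (x : Component e) : e.1 + x.1 = x.1 := by
  obtain ⟨y, hy⟩ := x.2.1
  rw [← hy, ← add_assoc, e.2]

theorem exists_neg {e : Idem M} (x : Component e) : ∃ y : Component e, y.1 + x.1 = e.1 := by
  obtain ⟨z, hz⟩ := x.2.2
  refine ⟨⟨e.1 + z, ⟨z, rfl⟩, ⟨x.1, ?_⟩⟩, ?_⟩
  · rw [add_assoc, add_comm z, hz, e.2]
  · change e.1 + z + x.1 = e.1
    rw [add_assoc, add_comm z, hz, e.2]

theorem add_mem {e : Idem M} (x y : Component e) :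
    AlgLE e.1 (x.1 + y.1) ∧ AlgLE (x.1 + y.1) e.1 := by
  obtain ⟨a, ha⟩ := x.2.1
  obtain ⟨b, hb⟩ := x.2.2
  obtain ⟨d, hd⟩ := y.2.2
  refine ⟨⟨a + y.1, by rw [← add_assoc, ha]⟩, ⟨b + d, ?_⟩⟩
  rw [add_add_add_comm, hb, hd, e.2]

instance instAdd (e : Idem M) : Add (Component e) := ⟨fun x y => ⟨x.1 + y.1, add_mem x y⟩⟩

instance instZero (e : Idem M) : Zero (Component e) := ⟨⟨e.1, ⟨e.1, e.2⟩, ⟨e.1, e.2⟩⟩⟩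

noncomputable instance instNeg (e : Idem M) : Neg (Component e) := ⟨fun x => (exists_neg x).choose⟩

/-- `M_e` is an abelian group under the addition of `M`, with zero element `e`. -/
noncomputable instance instAddCommGroup (e : Idem M) : AddCommGroup (Component e) where
  add_assoc x y z := Subtype.ext (add_assoc x.1 y.1 z.1)
  add_comm x y := Subtype.ext (add_comm x.1 y.1)
  zero_add x := Subtype.ext (idem_add x)
  add_zero x := Subtype.ext ((add_comm x.1 e.1).trans (idem_add x))
  neg_add_cancel x := Subtype.ext (exists_neg x).choose_spec
  nsmul := nsmulRec
  zsmul := zsmulRec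

/-- For idempotents `e ≤ f`, the group homomorphism `M_e → M_f`, `x ↦ x + f`. -/
def shift {e f : Idem M} (h : AlgLE e.1 f.1) : Component e →+ Component f where
  toFun x := ⟨x.1 + f.1, ⟨x.1, add_comm _ _⟩, by
    obtain ⟨z, hz⟩ := x.2.2
    obtain ⟨t, ht⟩ := h
    refine ⟨z + f.1, ?_⟩
    rw [add_add_add_comm, hz, f.2]
    rw [← ht, ← add_assoc, e.2]⟩
  map_zero' := Subtype.ext (by
    change e.1 + f.1 = f.1
    obtain ⟨t, ht⟩ := h
    rw [← ht, ← add_assoc, e.2])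
  map_add' x y := Subtype.ext (by
    change x.1 + y.1 + f.1 = x.1 + f.1 + (y.1 + f.1)
    rw [add_add_add_comm, f.2])

end Component

/-- A subgroup `H` of an abelian group `G` is pure if `nG ∩ H = nH` for all natural numbers `n`
(the case `n = 0` is trivially true). -/
def IsPure {G : Type u} [AddCommGroup G] (H : AddSubgroup G) : Prop :=
  ∀ (n : ℕ) (y : G), n • y ∈ H → ∃ z ∈ H, n • z = n • y

/-- `B` is (isomorphic to) a finite direct sum of monoids `(ℤ/nℤ) ⊔ {0}` with `n ≥ 1`. Here
`WithZero (ZMod n)` is the group `ℤ/nℤ` with a new additive identity adjoined, and a direct sum of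
finitely many abelian monoids is their product with componentwise addition. -/
def IsFiniteSumOfCyclic (B : Type) [AddCommMonoid B] : Prop :=
  ∃ (k : ℕ) (n : Fin k → ℕ), (∀ j, 0 < n j) ∧ Nonempty (B ≃+ (∀ j, WithZero (ZMod (n j))))

/-- `M` is (isomorphic to) the direct limit, over a nonempty directed partially ordered set
`ι : Type w`, of a direct system of finite direct sums of monoids `(ℤ/nℤ) ⊔ {0}` and monoid
homomorphisms. (Such finite sums are finite, so there is no loss in taking them in `Type`.) -/
def IsLimitOfCyclicSums (M : Type u) [AddCommMonoid M] : Prop :=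
  ∃ (ι : Type w) (_ : PartialOrder ι) (_ : IsDirectedOrder ι) (_ : Nonempty ι)
    (B : ι → Type) (_ : ∀ i, AddCommMonoid (B i))
    (φ : ∀ i j, i ≤ j → B i →+ B j) (_ : DirectedSystem B (φ · · ·)),
    (∀ i, IsFiniteSumOfCyclic (B i)) ∧ Nonempty (M ≃+ DirectLimit B φ)

end LimitsOfCyclicMonoids

open LimitsOfCyclicMonoids

namespace LimitsOfCyclicMonoids

section Groups

variable {G : Type u} [AddCommGroup G]

/-- A finite family `c` with `n s • c s = 0` which is independent with the orders `n s`. -/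
structure IsCyclicFamily {S : Type} [Fintype S] (n : S → ℕ) (c : S → G) : Prop where
  pos : ∀ s, 0 < n s
  smul_eq_zero : ∀ s, n s • c s = 0
  dvd : ∀ a : S → ℤ, ∑ s, a s • c s = 0 → ∀ s, (n s : ℤ) ∣ a s

theorem exists_cyclicFamily_of_finite (F : Type u) [AddCommGroup F] [Finite F] :
    ∃ (S : Type) (_ : Fintype S) (n : S → ℕ) (c : S → F), IsCyclicFamily n c ∧
      ∀ x : F, ∃ a : S → ℤ, x = ∑ s, a s • c s := by
  classical
  obtain ⟨S, hS, n, hn, ⟨e⟩⟩ := AddCommGroup.equiv_directSum_zmod_of_finite' F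
  let e' : F ≃+ (∀ s, ZMod (n s)) := e.trans (DirectSum.addEquivProd _)
  have key : ∀ a : S → ℤ, e' (∑ s, a s • e'.symm (Pi.single s 1)) = fun s => (a s : ZMod (n s)) := by
    intro a
    rw [map_sum]
    simp only [map_zsmul, AddEquiv.apply_symm_apply]
    funext s
    rw [Finset.sum_apply, Finset.sum_eq_single s]
    · simp
    · intro t _ hts
      simp [Pi.single_eq_of_ne hts.symm]
    · simp
  refine ⟨S, hS, n, fun s => e'.symm (Pi.single s 1), ⟨fun s => (hn s).le, fun s => ?_, ?_⟩, ?_⟩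
  · apply e'.injective
    rw [map_nsmul, AddEquiv.apply_symm_apply, map_zero, ← Pi.single_smul]
    simp
  · intro a ha s
    have := key a
    rw [ha, map_zero] at this
    exact (ZMod.intCast_zmod_eq_zero_iff_dvd _ _).1 (congrFun this s).symm
  · intro x
    refine ⟨fun s => (e' x s).cast, ?_⟩
    apply e'.injective
    rw [key]
    funext s
    simp

/-- Lifting of finite subgroups along a pure subgroup. -/
theorem exists_cyclicFamily_mod {ι : Type*} [Finite ι] (H K : AddSubgroup G) (hKH : K ≤ H)
    (htors : IsAddTorsion G)
    (hpure : ∀ (n : ℕ), ∀ y ∈ H, n • y ∈ K → ∃ z ∈ K, n • z = n • y)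
    (y : ι → G) (hy : ∀ i, y i ∈ H) :
    ∃ (S : Type) (_ : Fintype S) (n : S → ℕ) (c : S → G), (∀ s, 0 < n s) ∧ (∀ s, c s ∈ H) ∧
      (∀ s, n s • c s = 0) ∧
      (∀ a : S → ℤ, ∑ s, a s • c s ∈ K → ∀ s, (n s : ℤ) ∣ a s) ∧
      ∀ i, ∃ a : S → ℤ, y i - ∑ s, a s • c s ∈ K := by
  classical
  let F : AddSubgroup (G ⧸ K) := AddSubgroup.closure (Set.range fun i => (QuotientAddGroup.mk (y i) : G ⧸ K))
  have hFG : AddGroup.FG F := by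
    rw [AddGroup.fg_iff_addSubgroup_fg]
    exact ⟨(Set.finite_range fun i => (QuotientAddGroup.mk (y i) : G ⧸ K)).toFinset, by simp [F]⟩
  have hFT : IsAddTorsion F :=
    (htors.of_surjective (QuotientAddGroup.mk'_surjective K)).addSubgroup F
  have hFF : Finite F := AddCommGroup.finite_of_fg_isAddTorsion F hFT
  have hFH : ∀ x ∈ F, ∃ g ∈ H, (QuotientAddGroup.mk g : G ⧸ K) = x := by
    have : F ≤ H.map (QuotientAddGroup.mk' K) := by
      rw [AddSubgroup.closure_le]
      rintro _ ⟨i, rfl⟩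
      exact ⟨y i, hy i, rfl⟩
    intro x hx
    exact this hx
  obtain ⟨S, hS, n, f, hf, hspan⟩ := exists_cyclicFamily_of_finite F
  have : ∀ s, ∃ c ∈ H, n s • c = 0 ∧ (QuotientAddGroup.mk c : G ⧸ K) = f s := by
    intro s
    obtain ⟨g, hg, hgs⟩ := hFH (f s) (f s).2
    have h1 : n s • g ∈ K := by
      rw [← QuotientAddGroup.eq_zero_iff, QuotientAddGroup.mk_nsmul, hgs]
      exact_mod_cast congrArg Subtype.val (hf.smul_eq_zero s)
    obtain ⟨z, hz, hzn⟩ := hpure _ g hg h1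
    refine ⟨g - z, H.sub_mem hg (hKH hz), by rw [nsmul_sub, hzn, sub_self], ?_⟩
    rw [QuotientAddGroup.mk_sub, (QuotientAddGroup.eq_zero_iff z).2 hz, sub_zero, hgs]
  choose c hcH hcn hcf using this
  have hsum : ∀ a : S → ℤ, (QuotientAddGroup.mk (∑ s, a s • c s) : G ⧸ K) = (∑ s, a s • f s : F) := by
    intro a
    rw [QuotientAddGroup.mk_sum]
    simp [hcf]
  refine ⟨S, hS, n, c, hf.pos, hcH, hcn, fun a ha => hf.dvd a ?_, fun i => ?_⟩
  · apply Subtype.ext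
    rw [← hsum, (QuotientAddGroup.eq_zero_iff _).2 ha]
    rfl
  · obtain ⟨a, ha⟩ := hspan ⟨QuotientAddGroup.mk (y i), AddSubgroup.subset_closure ⟨i, rfl⟩⟩
    refine ⟨a, ?_⟩
    rw [← QuotientAddGroup.eq_zero_iff, QuotientAddGroup.mk_sub, hsum, ← ha, sub_self]

theorem exists_sub_mem_iSup_of_mem_iSup {P : Type*} (H : P → AddSubgroup G) {p q : P → Prop} {m : P}
    {x : G} (hx : x ∈ ⨆ j, ⨆ (_ : p j), H j) (hpq : ∀ j, p j → j ≠ m → q j) :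
    ∃ y ∈ H m, x - y ∈ ⨆ j, ⨆ (_ : q j), H j := by
  have : (⨆ j, ⨆ (_ : p j), H j) ≤ H m ⊔ ⨆ j, ⨆ (_ : q j), H j := by
    refine iSup₂_le fun j hj => ?_
    by_cases h : j = m
    · subst h; exact le_sup_left
    · exact (le_iSup₂ (f := fun j (_ : q j) => H j) j (hpq j hj h)).trans le_sup_right
  obtain ⟨y, hy, z, hz, rfl⟩ := AddSubgroup.mem_sup.1 (this hx)
  exact ⟨y, hy, by simpa using hz⟩

/-- A finite poset of pure subgroups that behaves like a distributive lattice of subgroups: finitely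
many elements are simultaneously contained in spans of a cyclic family adapted to the subgroups. -/
theorem exists_adapted_cyclicFamily {P : Type*} [PartialOrder P] [Finite P] (H : P → AddSubgroup G)
    (hmono : Monotone H) (htors : IsAddTorsion G)
    (hdist : ∀ m, ∀ x ∈ H m, x ∈ (⨆ j, ⨆ (_ : ¬ m ≤ j), H j) → x ∈ ⨆ j, ⨆ (_ : j < m), H j)
    (hpure : ∀ m, ∀ (n : ℕ), ∀ y ∈ H m, n • y ∈ (⨆ j, ⨆ (_ : j < m), H j) →
      ∃ z ∈ (⨆ j, ⨆ (_ : j < m), H j), n • z = n • y)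
    {ι : Type*} [Finite ι] (T : ι → LowerSet P) (D : Finset P) :
    IsLowerSet (D : Set P) → ∀ (x : ι → G) (_ : ∀ i, x i ∈ ⨆ j, ⨆ (_ : j ∈ D ∧ j ∈ T i), H j),
    ∃ (S : Type) (_ : Fintype S) (m : S → P) (n : S → ℕ) (c : S → G), IsCyclicFamily n c ∧
      (∀ s, c s ∈ H (m s)) ∧ (∀ s, m s ∈ D) ∧
      ∀ i, ∃ a : S → ℤ, (∀ s, a s ≠ 0 → m s ∈ T i) ∧ x i = ∑ s, a s • c s := by
  classical
  induction hk : D.card generalizing D with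
  | zero =>
    intro _ x hx
    obtain rfl := Finset.card_eq_zero.1 hk
    refine ⟨Empty, inferInstance, Empty.elim, Empty.elim, Empty.elim,
      ⟨fun s => s.elim, fun s => s.elim, fun _ _ s => s.elim⟩, fun s => s.elim, fun s => s.elim,
      fun i => ⟨0, by simp, ?_⟩⟩
    simpa using hx i
  | succ k ih =>
    intro hD x hx
    have hne : D.Nonempty := Finset.card_pos.1 (by omega)
    obtain ⟨m, hm⟩ := D.exists_maximal hne
    have hlow : IsLowerSet ((D.erase m : Finset P) : Set P) := by
      intro a b hba ha
      simp only [Finset.coe_erase, Set.mem_sdiff, Finset.mem_coe, Set.mem_singleton_iff] at ha ⊢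
      refine ⟨hD hba ha.1, ?_⟩
      rintro rfl
      exact ha.2 (le_antisymm (hm.2 ha.1 hba) hba)
    have step : ∀ i, ∃ y ∈ H m, (m ∉ T i → y = 0) ∧
        x i - y ∈ ⨆ j, ⨆ (_ : j ∈ D.erase m ∧ j ∈ T i), H j := by
      intro i
      by_cases hmT : m ∈ T i
      · obtain ⟨y, hy, hxy⟩ := exists_sub_mem_iSup_of_mem_iSup (m := m)
          (q := fun j => j ∈ D.erase m ∧ j ∈ T i) H (hx i)
          (fun j hj hjm => ⟨Finset.mem_erase.2 ⟨hjm, hj.1⟩, hj.2⟩)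
        exact ⟨y, hy, fun h => (h hmT).elim, hxy⟩
      · refine ⟨0, zero_mem _, fun _ => rfl, ?_⟩
        rw [sub_zero]
        have : (⨆ j, ⨆ (_ : j ∈ D ∧ j ∈ T i), H j) ≤
            ⨆ j, ⨆ (_ : j ∈ D.erase m ∧ j ∈ T i), H j := by
          refine iSup₂_le fun j hj => ?_
          refine le_iSup₂ (f := fun j (_ : j ∈ D.erase m ∧ j ∈ T i) => H j) j ⟨Finset.mem_erase.2 ⟨?_, hj.1⟩, hj.2⟩
          rintro rfl
          exact hmT hj.2
        exact this (hx i)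
    choose y hyH hy0 hyr using step
    obtain ⟨S, hS, n, c, hn, hcH, hnc, hdvd, hspan⟩ := exists_cyclicFamily_mod (H m)
      (⨆ j, ⨆ (_ : j < m), H j) (iSup₂_le fun j hj => hmono hj.le) htors (hpure m) y hyH
    have hspan' : ∀ i, ∃ a : S → ℤ, (∀ s, a s ≠ 0 → m ∈ T i) ∧
        x i - ∑ s, a s • c s ∈ ⨆ j, ⨆ (_ : j ∈ D.erase m ∧ j ∈ T i), H j := by
      intro i
      by_cases hmT : m ∈ T i
      · obtain ⟨a, ha⟩ := hspan i
        refine ⟨a, fun _ _ => hmT, ?_⟩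
        have h1 : (⨆ j, ⨆ (_ : j < m), H j) ≤ ⨆ j, ⨆ (_ : j ∈ D.erase m ∧ j ∈ T i), H j :=
          iSup₂_le fun j hj => le_iSup₂ (f := fun j (_ : j ∈ D.erase m ∧ j ∈ T i) => H j) j
            ⟨Finset.mem_erase.2 ⟨hj.ne, hD hj.le hm.1⟩, (T i).lower hj.le hmT⟩
        have := add_mem (hyr i) (h1 ha)
        rwa [sub_add_sub_cancel] at this
      · refine ⟨0, by simp, ?_⟩
        have := hyr i
        rw [hy0 i hmT] at this
        simpa using this
    choose a haT har using hspan'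
    obtain ⟨S', hS', m', n', c', hc', hcH', hmD', hspan''⟩ := ih (D.erase m)
      (by rw [Finset.card_erase_of_mem hm.1, hk]; rfl) hlow _ har
    refine ⟨S ⊕ S', inferInstance, Sum.elim (fun _ => m) m', Sum.elim n n', Sum.elim c c',
      ⟨?_, ?_, ?_⟩, ?_, ?_, ?_⟩
    · rintro (s | s)
      · exact hn s
      · exact hc'.pos s
    · rintro (s | s)
      · exact hnc s
      · exact hc'.smul_eq_zero s
    · intro b hb
      rw [Fintype.sum_sum_type] at hb
      simp only [Sum.elim_inl, Sum.elim_inr] at hb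
      have h1 : ∑ s, b (Sum.inl s) • c s ∈ H m :=
        sum_mem fun s _ => zsmul_mem (hcH s) _
      have h2 : ∑ s, b (Sum.inr s) • c' s ∈ ⨆ j, ⨆ (_ : ¬ m ≤ j), H j := by
        refine sum_mem fun s _ => zsmul_mem ?_ _
        refine (le_iSup₂ (f := fun j (_ : ¬ m ≤ j) => H j) (m' s) ?_) (hcH' s)
        intro hle
        have hs := Finset.mem_erase.1 (hmD' s)
        exact hs.1 (le_antisymm (hm.2 hs.2 hle) hle)
      have h3 := hdist m _ h1 (by rw [eq_neg_of_add_eq_zero_left hb]; exact neg_mem h2)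
      have h4 := hdvd _ h3
      have h5 : ∑ s, b (Sum.inl s) • c s = 0 := by
        refine Finset.sum_eq_zero fun s _ => ?_
        obtain ⟨t, ht⟩ := h4 s
        rw [ht, mul_comm, mul_smul, natCast_zsmul, hnc, smul_zero]
      rw [h5, zero_add] at hb
      rintro (s | s)
      · exact h4 s
      · exact hc'.dvd _ hb s
    · rintro (s | s)
      · exact hcH s
      · exact hcH' s
    · rintro (s | s)
      · exact hm.1
      · exact Finset.mem_of_mem_erase (hmD' s)
    · intro i
      obtain ⟨a', ha', hxa⟩ := hspan'' i
      refine ⟨Sum.elim (a i) a', ?_, ?_⟩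
      · rintro (s | s) hs
        · exact haT i s hs
        · exact ha' s hs
      · rw [Fintype.sum_sum_type]
        simp only [Sum.elim_inl, Sum.elim_inr]
        rw [← hxa]
        abel

end Groups

section Monoids

open Algebra

variable {M : Type u} [AddCommMonoid M]

namespace AlgLE

theorem refl (x : M) : AlgLE x x := ⟨0, add_zero x⟩

theorem trans {x y z : M} (h : AlgLE x y) (h' : AlgLE y z) : AlgLE x z := by
  obtain ⟨a, rfl⟩ := h
  obtain ⟨b, rfl⟩ := h'
  exact ⟨a + b, (add_assoc _ _ _).symm⟩

theorem zero_le (x : M) : AlgLE 0 x := ⟨x, zero_add x⟩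

theorem le_add_right (x y : M) : AlgLE x (x + y) := ⟨y, rfl⟩

theorem le_add_left (x y : M) : AlgLE y (x + y) := ⟨x, add_comm _ _⟩

theorem add {x y z w : M} (h : AlgLE x y) (h' : AlgLE z w) : AlgLE (x + z) (y + w) := by
  obtain ⟨a, rfl⟩ := h
  obtain ⟨b, rfl⟩ := h'
  exact ⟨a + b, add_add_add_comm _ _ _ _⟩

theorem add_le {x y e : M} (he : e + e = e) (h : AlgLE x e) (h' : AlgLE y e) :
    AlgLE (x + y) e := by
  have := h.add h'
  rwa [he] at this

theorem add_eq {x e : M} (he : e + e = e) (h : AlgLE e x) : x + e = x := by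
  obtain ⟨a, rfl⟩ := h
  rw [add_right_comm, he]

theorem le_sum {ι : Type*} (s : Finset ι) (f : ι → M) {i : ι} (hi : i ∈ s) :
    AlgLE (f i) (∑ j ∈ s, f j) := by
  classical
  rw [← Finset.add_sum_erase s f hi]
  exact le_add_right _ _

theorem sum_le {ι : Type*} (s : Finset ι) (f : ι → M) {e : M} (he : e + e = e)
    (h : ∀ i ∈ s, AlgLE (f i) e) : AlgLE (∑ j ∈ s, f j) e := by
  classical
  induction s using Finset.induction_on with
  | empty => exact zero_le e
  | insert a s ha ih =>
    rw [Finset.sum_insert ha]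
    exact add_le he (h a (Finset.mem_insert_self a s))
      (ih fun i hi => h i (Finset.mem_insert_of_mem hi))

end AlgLE

instance : PartialOrder (Idem M) where
  le e f := AlgLE e.1 f.1
  le_refl e := AlgLE.refl e.1
  le_trans _ _ _ h h' := h.trans h'
  le_antisymm e f h h' := Subtype.ext (by
    rw [← h'.add_eq f.2, add_comm, h.add_eq e.2])

theorem IsStronglyPeriodic.exists_idem (hper : IsStronglyPeriodic M) (x : M) :
    ∃ m : ℕ, 0 < m ∧ m • x + m • x = m • x ∧ AlgLE x (m • x) ∧ AlgLE (m • x) x := by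
  obtain ⟨m, hm, hx⟩ := hper x
  have hadd : x + m • x = x := by rwa [succ_nsmul'] at hx
  have key : ∀ k : ℕ, 0 < k → k • x + m • x = k • x := by
    intro k hk
    obtain ⟨k, rfl⟩ := Nat.exists_eq_succ_of_ne_zero hk.ne'
    rw [Nat.succ_eq_add_one, succ_nsmul, add_assoc, hadd]
  refine ⟨m, hm, key m hm, ?_, ⟨x, by rwa [add_comm]⟩⟩
  obtain ⟨k, rfl⟩ := Nat.exists_eq_succ_of_ne_zero hm.ne'
  exact ⟨k • x, by rw [Nat.succ_eq_add_one, succ_nsmul']⟩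

theorem grothendieck_of_eq_iff {x y : M} :
    GrothendieckAddGroup.of x = GrothendieckAddGroup.of y ↔ ∃ c : M, c + x = c + y := by
  change AddLocalization.addMonoidOf ⊤ x = AddLocalization.addMonoidOf ⊤ y ↔ _
  rw [← AddLocalization.mk_zero_eq_addMonoidOf_mk, ← AddLocalization.mk_zero_eq_addMonoidOf_mk,
    AddLocalization.mk_eq_mk_iff, AddLocalization.r_iff_exists]
  simp

theorem grothendieck_of_idem {e : M} (he : e + e = e) : GrothendieckAddGroup.of e = 0 := by
  have := congrArg (GrothendieckAddGroup.of (M := M)) he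
  rw [map_add] at this
  simpa using this

theorem IsStronglyPeriodic.exists_of_neg (hper : IsStronglyPeriodic M) (x : M) :
    ∃ k : ℕ, GrothendieckAddGroup.of (k • x) = -GrothendieckAddGroup.of x := by
  obtain ⟨m, hm, hx, -, -⟩ := hper.exists_idem x
  obtain ⟨k, rfl⟩ := Nat.exists_eq_succ_of_ne_zero hm.ne'
  refine ⟨k, ?_⟩
  rw [eq_neg_iff_add_eq_zero, ← map_add, ← succ_nsmul]
  exact grothendieck_of_idem hx

/-- The image of a submonoid in the Grothendieck group. -/
def gr (I : AddSubmonoid M) : AddSubgroup (GrothendieckAddGroup M) :=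
  AddSubgroup.closure (GrothendieckAddGroup.of '' (I : Set M))

theorem of_mem_gr {I : AddSubmonoid M} {x : M} (hx : x ∈ I) : GrothendieckAddGroup.of x ∈ gr I :=
  AddSubgroup.subset_closure ⟨x, hx, rfl⟩

theorem gr_mono {I J : AddSubmonoid M} (h : I ≤ J) : gr I ≤ gr J :=
  AddSubgroup.closure_mono (Set.image_mono h)

theorem mem_gr_iff (hper : IsStronglyPeriodic M) {I : AddSubmonoid M}
    {g : GrothendieckAddGroup M} : g ∈ gr I ↔ ∃ x ∈ I, GrothendieckAddGroup.of x = g := by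
  refine ⟨fun hg => ?_, fun ⟨x, hx, h⟩ => h ▸ of_mem_gr hx⟩
  induction hg using AddSubgroup.closure_induction with
  | mem g hg => exact hg
  | zero => exact ⟨0, I.zero_mem, map_zero _⟩
  | add a b _ _ ha hb =>
    obtain ⟨x, hx, rfl⟩ := ha
    obtain ⟨y, hy, rfl⟩ := hb
    exact ⟨x + y, I.add_mem hx hy, map_add _ _ _⟩
  | neg a _ ha =>
    obtain ⟨x, hx, rfl⟩ := ha
    obtain ⟨k, hk⟩ := hper.exists_of_neg x
    exact ⟨k • x, I.nsmul_mem hx k, hk⟩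

theorem exists_of_eq (hper : IsStronglyPeriodic M) (g : GrothendieckAddGroup M) :
    ∃ x : M, GrothendieckAddGroup.of x = g := by
  induction g using AddLocalization.ind with
  | _ p =>
    obtain ⟨a, b, -⟩ := p
    obtain ⟨k, hk⟩ := hper.exists_of_neg b
    refine ⟨a + k • b, ?_⟩
    rw [map_add, hk, ← sub_eq_add_neg, sub_eq_iff_eq_add]
    change AddLocalization.addMonoidOf ⊤ a = _ + AddLocalization.addMonoidOf ⊤ b
    rw [← AddLocalization.mk_zero_eq_addMonoidOf_mk, ← AddLocalization.mk_zero_eq_addMonoidOf_mk,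
      AddLocalization.mk_add, AddLocalization.mk_eq_mk_iff, AddLocalization.r_iff_exists]
    refine ⟨0, ?_⟩
    simp [add_comm]

theorem grothendieck_isAddTorsion (hper : IsStronglyPeriodic M) :
    IsAddTorsion (GrothendieckAddGroup M) := by
  intro g
  obtain ⟨x, rfl⟩ := exists_of_eq hper g
  obtain ⟨m, hm, hx, -, -⟩ := hper.exists_idem x
  rw [isOfFinAddOrder_iff_nsmul_eq_zero]
  exact ⟨m, hm, by rw [← map_nsmul]; exact grothendieck_of_idem hx⟩

/-- A submonoid that is downward closed for the algebraic preorder. -/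
def IsIdeal (I : AddSubmonoid M) : Prop :=
  ∀ x y : M, AlgLE x y → y ∈ I → x ∈ I

theorem IsRefinementMonoid.exists_of_le_add (href : IsRefinementMonoid M) {x y z : M}
    (h : AlgLE x (y + z)) : ∃ a b, x = a + b ∧ AlgLE a y ∧ AlgLE b z := by
  obtain ⟨w, hw⟩ := h
  obtain ⟨a, b, c, d, h1, -, h3, h4⟩ := href _ _ _ _ hw
  exact ⟨a, b, h1, ⟨c, h3.symm⟩, ⟨d, h4.symm⟩⟩

theorem IsConical.eq_zero_of_le (hcon : IsConical M) {x : M} (h : AlgLE x 0) : x = 0 := by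
  obtain ⟨z, hz⟩ := h
  exact (hcon _ _ hz).1

theorem IsRefinementMonoid.mem_of_le_sum (href : IsRefinementMonoid M) (hcon : IsConical M)
    {ι : Type*} (U : Finset ι) (f : ι → M) (K : AddSubmonoid M) {x : M}
    (hx : AlgLE x (∑ u ∈ U, f u)) (h : ∀ u ∈ U, ∀ z, AlgLE z (f u) → AlgLE z x → z ∈ K) : x ∈ K := by
  classical
  induction U using Finset.induction_on generalizing x with
  | empty =>
    rw [Finset.sum_empty] at hx
    rw [hcon.eq_zero_of_le hx]
    exact K.zero_mem
  | insert a U ha ih =>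
    rw [Finset.sum_insert ha] at hx
    obtain ⟨y, z, rfl, hy, hz⟩ := href.exists_of_le_add hx
    refine K.add_mem (h a (Finset.mem_insert_self a U) y hy (AlgLE.le_add_right _ _)) (ih hz ?_)
    intro u hu w hwu hwz
    exact h u (Finset.mem_insert_of_mem hu) w hwu (hwz.trans (AlgLE.le_add_left _ _))

theorem iSup_isIdeal (href : IsRefinementMonoid M) (hcon : IsConical M) {ι : Type*}
    (I : ι → AddSubmonoid M) (hI : ∀ i, IsIdeal (I i)) : IsIdeal (⨆ i, I i) := by
  intro x y hxy hy
  induction hy using AddSubmonoid.iSup_induction' generalizing x with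
  | mem i y hy => exact AddSubmonoid.mem_iSup_of_mem i (hI i x y hxy hy)
  | zero => rw [hcon.eq_zero_of_le hxy]; exact zero_mem _
  | add y z _ _ hy hz =>
    obtain ⟨a, b, rfl, ha, hb⟩ := href.exists_of_le_add hxy
    exact add_mem (hy a ha) (hz b hb)

theorem gr_iSup_le {ι : Type*} (I : ι → AddSubmonoid M) : gr (⨆ i, I i) ≤ ⨆ i, gr (I i) := by
  have : (⨆ i, I i) ≤ (⨆ i, gr (I i)).toAddSubmonoid.comap GrothendieckAddGroup.of :=
    iSup_le fun i x hx => (le_iSup (fun i => gr (I i)) i) (of_mem_gr hx)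
  refine (AddSubgroup.closure_le _).2 ?_
  rintro _ ⟨x, hx, rfl⟩
  exact this hx

theorem le_gr_iSup {ι : Type*} (I : ι → AddSubmonoid M) : ⨆ i, gr (I i) ≤ gr (⨆ i, I i) :=
  iSup_le fun i => gr_mono (le_iSup I i)

/-- An element is determined by its class in the Grothendieck group and the idempotent it is
equivalent to. -/
def IsGroupEmbedded (M : Type u) [AddCommMonoid M] : Prop :=
  ∀ x y : M, AlgLE x y → AlgLE y x → GrothendieckAddGroup.of x = GrothendieckAddGroup.of y → x = y

/-- Purity of the images of principal ideals in the Grothendieck group. -/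
def IsGroupPure (M : Type u) [AddCommMonoid M] : Prop :=
  ∀ (n : ℕ) (x y : M), n • GrothendieckAddGroup.of y = GrothendieckAddGroup.of x →
    ∃ z : M, AlgLE z x ∧ n • GrothendieckAddGroup.of z = GrothendieckAddGroup.of x

theorem mem_gr_inf (hper : IsStronglyPeriodic M) (href : IsRefinementMonoid M)
    (hemb : IsGroupEmbedded M) {I J : AddSubmonoid M} (hI : IsIdeal I) (hJ : IsIdeal J)
    {g : GrothendieckAddGroup M} (hgI : g ∈ gr I) (hgJ : g ∈ gr J) : g ∈ gr (I ⊓ J) := by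
  obtain ⟨x, hx, rfl⟩ := (mem_gr_iff hper).1 hgI
  obtain ⟨y, hy, hyx⟩ := (mem_gr_iff hper).1 hgJ
  obtain ⟨m, hm, he, hxe, hex⟩ := hper.exists_idem x
  obtain ⟨n, hn, hf, hyf, hfy⟩ := hper.exists_idem y
  have h : x + n • y = y + m • x := by
    apply hemb
    · rw [add_comm y]; exact hxe.add hfy
    · rw [add_comm x]; exact hyf.add hex
    · rw [map_add, map_add, grothendieck_of_idem he, grothendieck_of_idem hf, hyx]
  obtain ⟨a, b, c, d, h1, h2, h3, h4⟩ := href _ _ _ _ h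
  have hsub : GrothendieckAddGroup.of x = GrothendieckAddGroup.of a - GrothendieckAddGroup.of d := by
    have h5 := grothendieck_of_idem he
    rw [h4, map_add] at h5
    rw [h1, map_add, eq_neg_of_add_eq_zero_left h5, sub_eq_add_neg]
  rw [hsub]
  refine sub_mem (of_mem_gr ⟨hI a x ⟨b, h1.symm⟩ hx, hJ a y ⟨c, h3.symm⟩ hy⟩) (of_mem_gr ⟨?_, ?_⟩)
  · refine hI d (m • x) ⟨b, ?_⟩ (I.nsmul_mem hx m)
    rw [h4, add_comm]
  · refine hJ d (n • y) ⟨c, ?_⟩ (J.nsmul_mem hy n)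
    rw [h2, add_comm]

theorem gr_pure (hper : IsStronglyPeriodic M) (hpure : IsGroupPure M) {I : AddSubmonoid M}
    (hI : IsIdeal I) (n : ℕ) (g : GrothendieckAddGroup M) (hg : n • g ∈ gr I) :
    ∃ z ∈ gr I, n • z = n • g := by
  obtain ⟨y, rfl⟩ := exists_of_eq hper g
  obtain ⟨x, hx, hxy⟩ := (mem_gr_iff hper).1 hg
  obtain ⟨z, hz, hzx⟩ := hpure n x y hxy.symm
  exact ⟨_, of_mem_gr (hI z x hz hx), hzx.trans hxy⟩

theorem isGroupEmbedded (hper : IsStronglyPeriodic M)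
    (h : ∀ (e f : Idem M) (h : AlgLE e.1 f.1), Function.Injective (Component.shift h)) :
    IsGroupEmbedded M := by
  intro x y hxy hyx hG
  obtain ⟨c, hc⟩ := grothendieck_of_eq_iff.1 hG
  obtain ⟨m, hm, he, hxe, hex⟩ := hper.exists_idem x
  obtain ⟨n, hn, hf, hcf, hfc⟩ := hper.exists_idem c
  let e : Idem M := ⟨m • x, he⟩
  let f : Idem M := ⟨m • x + n • c, by rw [add_add_add_comm, he, hf]⟩
  let x' : Component e := ⟨x, hex, hxe⟩
  let y' : Component e := ⟨y, hex.trans hxy, hyx.trans hxe⟩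
  have hef : AlgLE e.1 f.1 := AlgLE.le_add_right _ _
  refine congrArg Subtype.val (h e f hef (a₁ := x') (a₂ := y') (Subtype.ext ?_))
  change x + (m • x + n • c) = y + (m • x + n • c)
  obtain ⟨t, ht⟩ := hcf
  rw [← ht, add_left_comm, ← add_assoc x, add_comm x, hc, add_left_comm y, ← add_assoc y,
    add_comm y]

theorem Component.nsmul_val {e : Idem M} (x : Component e) (n : ℕ) :
    (n • x).1 + e.1 = n • x.1 + e.1 := by
  induction n with
  | zero =>
    rw [zero_nsmul, zero_nsmul, zero_add]
    exact e.2
  | succ n ih =>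
    rw [succ_nsmul, succ_nsmul]
    change (n • x).1 + x.1 + e.1 = _
    rw [add_right_comm, ih, add_right_comm]

theorem Component.of_nsmul {e : Idem M} (x : Component e) (n : ℕ) :
    GrothendieckAddGroup.of (n • x).1 = n • GrothendieckAddGroup.of x.1 := by
  have := congrArg (GrothendieckAddGroup.of (M := M)) (Component.nsmul_val x n)
  rwa [map_add, map_add, grothendieck_of_idem e.2, add_zero, add_zero, map_nsmul] at this

theorem isGroupPure (hper : IsStronglyPeriodic M) (hemb : IsGroupEmbedded M)
    (h : ∀ (e f : Idem M) (h : AlgLE e.1 f.1), IsPure (Component.shift h).range) :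
    IsGroupPure M := by
  intro n x y hxy
  obtain ⟨m, hm, he, hxe, hex⟩ := hper.exists_idem x
  obtain ⟨k, hk, hf, hyf, hfy⟩ := hper.exists_idem y
  let e : Idem M := ⟨m • x, he⟩
  let f : Idem M := ⟨m • x + k • y, by rw [add_add_add_comm, he, hf]⟩
  have hef : AlgLE e.1 f.1 := AlgLE.le_add_right _ _
  have hof : GrothendieckAddGroup.of f.1 = 0 := grothendieck_of_idem f.2
  let x' : Component e := ⟨x, hex, hxe⟩
  let y' : Component f := ⟨m • x + y, (AlgLE.refl _).add hfy, (AlgLE.refl _).add hyf⟩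
  have hy' : GrothendieckAddGroup.of y'.1 = GrothendieckAddGroup.of y := by
    change GrothendieckAddGroup.of (m • x + y) = _
    rw [map_add, grothendieck_of_idem he, zero_add]
  have hrange : n • y' ∈ (Component.shift hef).range := by
    refine ⟨x', Subtype.ext ?_⟩
    have h1 := (n • y').2
    have h2 := (Component.shift hef x').2
    refine hemb _ _ (h2.2.trans h1.1) (h1.2.trans h2.1) ?_
    rw [Component.of_nsmul, hy', hxy]
    change GrothendieckAddGroup.of (x + f.1) = _
    rw [map_add, hof, add_zero]
  obtain ⟨_, ⟨z, rfl⟩, hz⟩ := h e f hef n y' hrange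
  refine ⟨z.1, z.2.2.trans hex, ?_⟩
  have := congrArg (fun t : Component f => GrothendieckAddGroup.of t.1) hz
  simp only [Component.of_nsmul, hy'] at this
  rw [← hxy, ← this]
  change _ = n • GrothendieckAddGroup.of (z.1 + f.1)
  rw [map_add, hof, add_zero]

end Monoids

section Local

open Algebra

variable {M : Type u} [AddCommMonoid M]

/-- The idempotents of `M` that lie in the submonoid `N`. -/
abbrev IdemIn (N : AddSubmonoid M) : Type u := {e : Idem M // e.1 ∈ N}

/-- The ideal of all `x` below every idempotent of `N` that is not below `m`. -/
def cofilterIdeal {N : AddSubmonoid M} (m : IdemIn N) : AddSubmonoid M where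
  carrier := {x | ∀ f : IdemIn N, ¬ f ≤ m → AlgLE x f.1.1}
  zero_mem' := fun _ _ => AlgLE.zero_le _
  add_mem' hx hy f hf := AlgLE.add_le f.1.2 (hx f hf) (hy f hf)

theorem cofilterIdeal_isIdeal {N : AddSubmonoid M} (m : IdemIn N) : IsIdeal (cofilterIdeal m) :=
  fun _ _ hxy hy f hf => hxy.trans (hy f hf)

theorem cofilterIdeal_mono {N : AddSubmonoid M} : Monotone (cofilterIdeal (N := N)) :=
  fun _ _ hmm' _ hx f hf => hx f fun h => hf (h.trans hmm')

theorem biSup_isIdeal (href : IsRefinementMonoid M) (hcon : IsConical M) {N : AddSubmonoid M}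
    (q : IdemIn N → Prop) : IsIdeal (⨆ j, ⨆ (_ : q j), cofilterIdeal j) := by
  rw [iSup_subtype']
  exact iSup_isIdeal href hcon _ fun j => cofilterIdeal_isIdeal j.1

theorem mem_iSup_cofilterIdeal (href : IsRefinementMonoid M) (hcon : IsConical M)
    {N : AddSubmonoid M} [Fintype (IdemIn N)] (T : Finset (IdemIn N)) {x : M}
    (hx : ∀ f ∈ T, AlgLE x f.1.1) : x ∈ ⨆ j, ⨆ (_ : j ∉ T), cofilterIdeal j := by
  classical
  induction hk : Tᶜ.card using Nat.strong_induction_on generalizing T x with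
  | _ k ih =>
    have hidem : (∑ u ∈ Tᶜ, u.1.1) + (∑ u ∈ Tᶜ, u.1.1) = ∑ u ∈ Tᶜ, u.1.1 := by
      rw [← Finset.sum_add_distrib]
      exact Finset.sum_congr rfl fun u _ => u.1.2
    let j : IdemIn N := ⟨⟨∑ u ∈ Tᶜ, u.1.1, hidem⟩, N.sum_mem fun u _ => u.2⟩
    have hj : ∀ f, f ∉ T → f ≤ j := fun f hf =>
      AlgLE.le_sum Tᶜ (fun u : IdemIn N => u.1.1) (Finset.mem_compl.2 hf)
    by_cases hxj : AlgLE x j.1.1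
    · refine href.mem_of_le_sum hcon Tᶜ (fun u : IdemIn N => u.1.1) _ hxj fun u hu z hzu hzx => ?_
      have hu' := Finset.mem_compl.1 hu
      have h1 : z ∈ ⨆ j, ⨆ (_ : j ∉ insert u T), cofilterIdeal j := by
        refine ih _ ?_ (insert u T) (x := z) ?_ rfl
        · rw [← hk]
          exact Finset.card_lt_card (Finset.compl_ssubset_compl.2 (Finset.ssubset_insert hu'))
        · intro f hf
          rcases Finset.mem_insert.1 hf with rfl | hf
          · exact hzu
          · exact hzx.trans (hx f hf)
      refine (iSup₂_le fun i hi => ?_ : (⨆ j, ⨆ (_ : j ∉ insert u T), cofilterIdeal j) ≤ _) h1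
      exact le_iSup₂ (f := fun i (_ : i ∉ T) => cofilterIdeal i) i
        fun h => hi (Finset.mem_insert_of_mem h)
    · have hjT : j ∉ T := fun h => hxj (hx j h)
      refine (le_iSup₂ (f := fun i (_ : i ∉ T) => cofilterIdeal i) j hjT) ?_
      intro f hf
      exact hx f (by by_contra h; exact hf (hj f h))

theorem mem_iSup_lt (href : IsRefinementMonoid M) (hcon : IsConical M)
    {N : AddSubmonoid M} [Finite (IdemIn N)] (m : IdemIn N) {x : M} (hx : x ∈ cofilterIdeal m)
    (hx' : x ∈ ⨆ j, ⨆ (_ : ¬ m ≤ j), cofilterIdeal j) :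
    x ∈ ⨆ j, ⨆ (_ : j < m), cofilterIdeal j := by
  classical
  have := Fintype.ofFinite (IdemIn N)
  rw [iSup_subtype'] at hx'
  induction hx' using AddSubmonoid.iSup_induction' with
  | zero => exact zero_mem _
  | add y z _ _ hy hz =>
    exact add_mem (hy (cofilterIdeal_isIdeal m _ _ (AlgLE.le_add_right _ _) hx))
      (hz (cofilterIdeal_isIdeal m _ _ (AlgLE.le_add_left _ _) hx))
  | mem i y hy =>
    have h1 := mem_iSup_cofilterIdeal href hcon
      (Finset.univ.filter fun f : IdemIn N => ¬ f ≤ m ∨ ¬ f ≤ i.1) (x := y) (by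
        intro f hf
        rcases (Finset.mem_filter.1 hf).2 with h | h
        · exact hx f h
        · exact hy f h)
    refine (iSup₂_le fun j hj => ?_ : _ ≤ ⨆ j, ⨆ (_ : j < m), cofilterIdeal j) h1
    have hj' : j ≤ m ∧ j ≤ i.1 := by simpa [not_or] using hj
    refine le_iSup₂ (f := fun j (_ : j < m) => cofilterIdeal j) j (lt_of_le_of_ne hj'.1 ?_)
    rintro rfl
    exact i.2 hj'.2

theorem gr_biSup {N : AddSubmonoid M} (q : IdemIn N → Prop) :
    gr (⨆ j, ⨆ (_ : q j), cofilterIdeal j) = ⨆ j, ⨆ (_ : q j), gr (cofilterIdeal j) := by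
  rw [iSup_subtype', iSup_subtype']
  exact le_antisymm (gr_iSup_le _) (le_gr_iSup _)

theorem exists_sum_of_mem_biSup {P : Type*} [Fintype P] (I : P → AddSubmonoid M) (q : P → Prop)
    {x : M} (hx : x ∈ ⨆ j, ⨆ (_ : q j), I j) :
    ∃ v : P → M, (∀ j, v j ∈ I j) ∧ (∀ j, ¬ q j → v j = 0) ∧ x = ∑ j, v j := by
  classical
  rw [iSup_subtype'] at hx
  induction hx using AddSubmonoid.iSup_induction' with
  | zero => exact ⟨0, fun j => zero_mem _, fun _ _ => rfl, by simp⟩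
  | add y z _ _ hy hz =>
    obtain ⟨v, h1, h2, rfl⟩ := hy
    obtain ⟨w, h3, h4, rfl⟩ := hz
    exact ⟨v + w, fun j => add_mem (h1 j) (h3 j), fun j hj => by simp [h2 j hj, h4 j hj],
      by simp [Finset.sum_add_distrib]⟩
  | mem i y hy =>
    refine ⟨Pi.single i.1 y, fun j => ?_, fun j hj => ?_, by simp⟩
    · by_cases h : j = i.1
      · subst h; simpa using hy
      · simp [h]
    · rw [Pi.single_eq_of_ne]
      rintro rfl
      exact hj i.2

theorem not_le_lower {N : AddSubmonoid M} (x : M) :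
    IsLowerSet {j : IdemIn N | ¬ AlgLE x j.1.1} := fun _ _ hba ha hb => ha (hb.trans hba)

theorem le_of_mem_cofilterIdeal (hper : IsStronglyPeriodic M) {N : AddSubmonoid M} {x y : M}
    (hx : x ∈ N) {m : IdemIn N} (hxm : ¬ AlgLE x m.1.1) (hy : y ∈ cofilterIdeal m) : AlgLE y x := by
  obtain ⟨k, -, hk, h1, h2⟩ := hper.exists_idem x
  exact (hy ⟨⟨k • x, hk⟩, N.nsmul_mem hx k⟩ fun h => hxm (h1.trans h)).trans h2

theorem exists_idem_generators (hper : IsStronglyPeriodic M) (href : IsRefinementMonoid M)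
    (hcon : IsConical M) (N : AddSubmonoid M) [Fintype (IdemIn N)] :
    ∃ w : IdemIn N → M, (∀ j, w j + w j = w j) ∧ (∀ j, w j ∈ cofilterIdeal j) ∧
      ∀ e : IdemIn N, ∃ v : IdemIn N → M, (∀ j, AlgLE (v j) (w j)) ∧
        (∀ j, e ≤ j → v j = 0) ∧ e.1.1 = ∑ j, v j := by
  classical
  have h1 : ∀ e : IdemIn N, ∃ v : IdemIn N → M, (∀ j, v j ∈ cofilterIdeal j) ∧
      (∀ j, ¬ ¬ e ≤ j → v j = 0) ∧ e.1.1 = ∑ j, v j := by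
    intro e
    refine exists_sum_of_mem_biSup _ _ ?_
    simpa using mem_iSup_cofilterIdeal href hcon (Finset.univ.filter fun f : IdemIn N => e ≤ f)
      (x := e.1.1) (fun f hf => (Finset.mem_filter.1 hf).2)
  choose v hv hv0 hve using h1
  have h2 := fun j : IdemIn N => hper.exists_idem (∑ e, v e j)
  choose k hk0 hk hle hge using h2
  refine ⟨fun j => k j • ∑ e, v e j, hk, fun j => ?_, fun e => ⟨v e, fun j => ?_, fun j hj => ?_, hve e⟩⟩
  · exact (cofilterIdeal j).nsmul_mem (sum_mem fun e _ => hv e j) _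
  · exact (AlgLE.le_sum Finset.univ (fun e => v e j) (Finset.mem_univ e)).trans (hle j)
  · exact hv0 e j (not_not.2 hj)

open Classical in
theorem exists_adapted_elements (hper : IsStronglyPeriodic M) (hcon : IsConical M)
    (href : IsRefinementMonoid M) (hemb : IsGroupEmbedded M) (hpure : IsGroupPure M)
    (N : AddSubmonoid M) [Finite N] :
    ∃ (S : Type) (_ : Fintype S) (m : S → IdemIn N) (n : S → ℕ) (w : S → M),
      IsCyclicFamily n (fun s => GrothendieckAddGroup.of (w s)) ∧
      (∀ s, w s ∈ cofilterIdeal (m s)) ∧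
      (∀ x ∈ N, ∃ a : S → ℤ, (∀ s, a s ≠ 0 → ¬ AlgLE x (m s).1.1) ∧
        GrothendieckAddGroup.of x = ∑ s, a s • GrothendieckAddGroup.of (w s)) ∧
      ∀ x ∈ N, AlgLE x (∑ s with ¬ AlgLE x (m s).1.1, w s) := by
  have hfin : Finite (IdemIn N) :=
    Finite.of_injective (fun e : IdemIn N => (⟨e.1.1, e.2⟩ : N)) fun e f h =>
      Subtype.ext (Subtype.ext (show e.1.1 = f.1.1 from congrArg (fun t : N => t.1) h))
  have := Fintype.ofFinite (IdemIn N)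
  obtain ⟨S, hS, m, n, c, hc, hcm, -, hspan⟩ := exists_adapted_cyclicFamily
    (fun j : IdemIn N => gr (cofilterIdeal j)) (fun _ _ h => gr_mono (cofilterIdeal_mono h))
    (grothendieck_isAddTorsion hper)
    (by
      intro m g hg hg'
      rw [← gr_biSup] at hg' ⊢
      have h1 := mem_gr_inf hper href hemb (cofilterIdeal_isIdeal m)
        (biSup_isIdeal href hcon _) hg hg'
      have h2 : cofilterIdeal m ⊓ (⨆ j, ⨆ (_ : ¬ m ≤ j), cofilterIdeal j) ≤
          ⨆ j, ⨆ (_ : j < m), cofilterIdeal j :=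
        fun x hx => mem_iSup_lt href hcon m hx.1 hx.2
      exact gr_mono h2 h1)
    (by
      intro m n y _ hy
      rw [← gr_biSup] at hy ⊢
      exact gr_pure hper hpure (biSup_isIdeal href hcon _) n y hy)
    (fun x : N => ⟨_, not_le_lower x.1⟩) Finset.univ (by simpa using isLowerSet_univ)
    (fun x : N => GrothendieckAddGroup.of x.1)
    (by
      intro x
      have h1 := of_mem_gr (mem_iSup_cofilterIdeal href hcon
        (Finset.univ.filter fun f : IdemIn N => AlgLE x.1 f.1.1)
        (x := x.1) (fun f hf => (Finset.mem_filter.1 hf).2))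
      rw [gr_biSup] at h1
      simpa using h1)
  choose w hw hwc using fun s => (mem_gr_iff hper).1 (hcm s)
  obtain ⟨u, hu, hum, hue⟩ := exists_idem_generators hper href hcon N
  let σ := (Fintype.equivFin (IdemIn N)).symm
  refine ⟨S ⊕ Fin (Fintype.card (IdemIn N)), inferInstance, Sum.elim m σ, Sum.elim n (fun _ => 1),
    Sum.elim w (fun i => u (σ i)), ⟨?_, ?_, ?_⟩, ?_, ?_, ?_⟩
  · rintro (s | s)
    · exact hc.pos s
    · exact Nat.one_pos
  · rintro (s | s)
    · simp only [Sum.elim_inl, hwc]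
      exact hc.smul_eq_zero s
    · simp only [Sum.elim_inr, one_smul]
      exact grothendieck_of_idem (hu _)
  · intro a ha
    rw [Fintype.sum_sum_type] at ha
    simp only [Sum.elim_inl, Sum.elim_inr, hwc, grothendieck_of_idem (hu _), smul_zero,
      Finset.sum_const_zero, add_zero] at ha
    rintro (s | s)
    · exact hc.dvd _ ha s
    · simp
  · rintro (s | s)
    · exact hw s
    · exact hum _
  · intro x hx
    obtain ⟨a, ha, hxa⟩ := hspan ⟨x, hx⟩
    refine ⟨Sum.elim a 0, ?_, ?_⟩
    · rintro (s | s) hs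
      · exact ha s hs
      · exact (hs rfl).elim
    · rw [Fintype.sum_sum_type]
      simp only [Sum.elim_inl, Sum.elim_inr, hwc, Pi.zero_apply, zero_smul,
        Finset.sum_const_zero, add_zero]
      exact hxa
  · intro x hx
    obtain ⟨k, -, hk, h1, h2⟩ := hper.exists_idem x
    obtain ⟨v, hv, hv0, hve⟩ := hue ⟨⟨k • x, hk⟩, N.nsmul_mem hx k⟩
    refine h1.trans ?_
    rw [show k • x = ∑ j, v j from hve, ← Equiv.sum_comp σ]
    have hall : ∀ t : Finset (Fin (Fintype.card (IdemIn N))), AlgLE (∑ i ∈ t, v (σ i))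
        (∑ i ∈ t with ¬ AlgLE x (σ i).1.1, u (σ i)) := by
      intro t
      induction t using Finset.induction_on with
      | empty => exact AlgLE.refl _
      | insert i t hi ih =>
        rw [Finset.sum_insert hi, Finset.filter_insert]
        split_ifs with hxi
        · rw [hv0 _ (h2.trans hxi), zero_add]
          exact ih
        · rw [Finset.sum_insert (fun h => hi (Finset.mem_filter.1 h).1)]
          exact (hv _).add ih
    refine (hall Finset.univ).trans ?_
    rw [Finset.sum_filter, Finset.sum_filter, Fintype.sum_sum_type]
    exact AlgLE.le_add_left _ _

theorem nsmul_add_nsmul_mod {w : M} {n : ℕ} (hn : 0 < n) (h : n • w + w = w) (k : ℕ) :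
    k • w + n • w = (k % n) • w + n • w := by
  have h1 : ∀ k : ℕ, 0 < k → k • w + n • w = k • w := by
    intro k hk
    obtain ⟨k, rfl⟩ := Nat.exists_eq_succ_of_ne_zero hk.ne'
    rw [Nat.succ_eq_add_one, succ_nsmul, add_assoc, add_comm w, h]
  have h2 : ∀ q : ℕ, (n * q) • w + n • w = n • w := by
    intro q
    induction q with
    | zero => simp
    | succ q ih => rw [mul_add, mul_one, add_nsmul, add_assoc, h1 n hn, ih]
  conv_lhs => rw [← Nat.mod_add_div k n, add_nsmul, add_assoc, h2]

/-- The homomorphism from `(ℤ/nℤ) ⊔ {0}` that sends `1 ∈ ℤ/nℤ` to `w`. -/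
def cyclicHom (n : ℕ) (w : M) (hn : 0 < n) (h : n • w + w = w) : WithZero (ZMod n) →+ M :=
  WithZero.lift
    { toFun := fun a => a.val • w + n • w
      map_add' := fun a b => by
        have : NeZero n := ⟨hn.ne'⟩
        have hnn := nsmul_add_nsmul_mod hn h n
        rw [Nat.mod_self, zero_nsmul, zero_add] at hnn
        rw [ZMod.val_add, ← nsmul_add_nsmul_mod hn h, add_nsmul, add_add_add_comm, hnn] }

theorem cyclicHom_coe (n : ℕ) (w : M) (hn : 0 < n) (h : n • w + w = w) (a : ZMod n) :
    cyclicHom n w hn h (a : WithZero (ZMod n)) = a.val • w + n • w :=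
  WithZero.lift_coe _ _

/-- Every finite submonoid embeds into `M` through a finite sum of monoids `(ℤ/nℤ) ⊔ {0}`. -/
theorem exists_factorization (hper : IsStronglyPeriodic M) (hcon : IsConical M)
    (href : IsRefinementMonoid M) (hemb : IsGroupEmbedded M) (hpure : IsGroupPure M)
    (N : AddSubmonoid M) [Finite N] :
    ∃ (S : Type) (_ : Fintype S) (n : S → ℕ) (_ : ∀ s, 0 < n s)
      (α : N →+ ∀ s, WithZero (ZMod (n s))) (β : (∀ s, WithZero (ZMod (n s))) →+ M),
      ∀ x, β (α x) = x.1 := by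
  classical
  obtain ⟨S, hS, m, n, w, hcyc, hwm, hspan, hcov⟩ :=
    exists_adapted_elements hper hcon href hemb hpure N
  choose a ha hxa using fun x : N => hspan x.1 x.2
  have hw : ∀ s, n s • w s + w s = w s := by
    intro s
    obtain ⟨k, hk0, hk, h1, h2⟩ := hper.exists_idem (w s)
    have hle : ∀ j : ℕ, AlgLE (j • w s) (k • w s) := by
      intro j
      induction j with
      | zero => rw [zero_nsmul]; exact AlgLE.zero_le _
      | succ j ih => rw [succ_nsmul]; exact AlgLE.add_le hk ih h1
    refine hemb _ _ ?_ (AlgLE.le_add_left _ _) ?_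
    · exact (AlgLE.add_le hk (hle _) h1).trans h2
    · rw [map_add, map_nsmul, hcyc.smul_eq_zero, zero_add]
  let α : N →+ ∀ s, WithZero (ZMod (n s)) :=
    { toFun := fun x s => if AlgLE x.1 (m s).1.1 then 0 else ((a x s : ZMod (n s)) : WithZero _)
      map_zero' := by
        funext s
        exact if_pos (AlgLE.zero_le _)
      map_add' := by
        intro x y
        funext s
        have hadd : (a (x + y) s : ZMod (n s)) = a x s + a y s := by
          have h1 := hcyc.dvd (fun s => a (x + y) s - (a x s + a y s)) (by
            simp only [sub_smul, add_smul, Finset.sum_sub_distrib, Finset.sum_add_distrib]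
            rw [← hxa, ← hxa, ← hxa, ← map_add, sub_eq_zero]
            rfl) s
          rw [← Int.cast_add, ← sub_eq_zero, ← Int.cast_sub]
          exact (ZMod.intCast_zmod_eq_zero_iff_dvd _ _).2 h1
        have h0 : ∀ z : N, AlgLE z.1 (m s).1.1 → a z s = 0 := fun z hz =>
          by_contra fun h => ha z s h hz
        have hiff : AlgLE (x + y).1 (m s).1.1 ↔ AlgLE x.1 (m s).1.1 ∧ AlgLE y.1 (m s).1.1 :=
          ⟨fun h => ⟨(AlgLE.le_add_right _ _).trans h, (AlgLE.le_add_left _ _).trans h⟩,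
            fun h => AlgLE.add_le (m s).1.2 h.1 h.2⟩
        simp only [Pi.add_apply, hiff]
        by_cases hx : AlgLE x.1 (m s).1.1 <;> by_cases hy : AlgLE y.1 (m s).1.1
        · simp [hx, hy]
        · simp [hx, hy, hadd, h0 x hx]
        · simp [hx, hy, hadd, h0 y hy]
        · simp [hx, hy, hadd] }
  let β : (∀ s, WithZero (ZMod (n s))) →+ M :=
    ∑ s, (cyclicHom (n s) (w s) (hcyc.pos s) (hw s)).comp (Pi.evalAddMonoidHom _ s)
  refine ⟨S, hS, n, hcyc.pos, α, β, fun x => ?_⟩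
  have hval : β (α x) = ∑ s with ¬ AlgLE x.1 (m s).1.1,
      ((a x s : ZMod (n s)).val • w s + n s • w s) := by
    rw [Finset.sum_filter]
    simp only [β, AddMonoidHom.finsetSum_apply]
    refine Finset.sum_congr rfl fun s _ => ?_
    simp only [α, AddMonoidHom.comp_apply, Pi.evalAddMonoidHom_apply, AddMonoidHom.coe_mk,
      ZeroHom.coe_mk]
    split_ifs
    · exact map_zero _
    · rw [cyclicHom_coe]
  rw [hval]
  apply hemb
  · obtain ⟨k, -, hk, h1, h2⟩ := hper.exists_idem x.1
    refine AlgLE.trans (AlgLE.sum_le _ _ hk fun s hs => ?_) h2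
    have hs' := (Finset.mem_filter.1 hs).2
    refine (le_of_mem_cofilterIdeal hper x.2 hs' ?_).trans h1
    exact add_mem (nsmul_mem (hwm s) _) (nsmul_mem (hwm s) _)
  · refine (hcov x.1 x.2).trans ?_
    have hall : ∀ t : Finset S, AlgLE (∑ s ∈ t, w s)
        (∑ s ∈ t, ((a x s : ZMod (n s)).val • w s + n s • w s)) := by
      intro t
      induction t using Finset.induction_on with
      | empty => exact AlgLE.refl _
      | insert s t hs ih =>
        rw [Finset.sum_insert hs, Finset.sum_insert hs]
        refine AlgLE.add ?_ ih
        refine AlgLE.trans ?_ (AlgLE.le_add_left _ _)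
        obtain ⟨k, hk⟩ := Nat.exists_eq_succ_of_ne_zero (hcyc.pos s).ne'
        rw [hk, Nat.succ_eq_add_one, succ_nsmul]
        exact AlgLE.le_add_left _ _
    exact hall _
  · rw [map_sum, hxa x, Finset.sum_filter]
    refine Finset.sum_congr rfl fun s _ => ?_
    have : NeZero (n s) := ⟨(hcyc.pos s).ne'⟩
    split_ifs with h
    · rw [show a x s = 0 from by_contra fun h' => ha x s h' h, zero_smul]
    · rw [map_add, map_nsmul, map_nsmul, hcyc.smul_eq_zero, add_zero, ← natCast_zsmul,
        ← sub_eq_zero, ← sub_smul]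
      have h1 : ((n s : ℕ) : ℤ) ∣ ((a x s : ZMod (n s)).val : ℤ) - a x s := by
        rw [← ZMod.intCast_zmod_eq_zero_iff_dvd]
        simp
      obtain ⟨t, ht⟩ := h1
      rw [ht, mul_comm, mul_smul, natCast_zsmul, hcyc.smul_eq_zero, smul_zero]

end Local

section Limit

variable {M : Type u} [AddCommMonoid M]

theorem finite_sup {A B : AddSubmonoid M} (hA : Finite A) (hB : Finite B) :
    Finite (A ⊔ B : AddSubmonoid M) := by
  refine Finite.of_surjective (fun p : A × B => (⟨p.1.1 + p.2.1,
    AddSubmonoid.add_mem_sup p.1.2 p.2.2⟩ : (A ⊔ B : AddSubmonoid M))) ?_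
  rintro ⟨x, hx⟩
  obtain ⟨a, ha, b, hb, rfl⟩ := AddSubmonoid.mem_sup.1 hx
  exact ⟨(⟨a, ha⟩, ⟨b, hb⟩), rfl⟩

theorem IsStronglyPeriodic.finite_multiples (hper : IsStronglyPeriodic M) (x : M) :
    Finite (AddSubmonoid.multiples x) := by
  obtain ⟨m, hm, hx⟩ := hper x
  have key : ∀ k : ℕ, ∃ l : Fin (m + 1), l.1 • x = k • x := by
    intro k
    induction k with
    | zero => exact ⟨0, rfl⟩
    | succ k ih =>
      obtain ⟨l, hl⟩ := ih
      by_cases h : l.1 + 1 < m + 1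
      · exact ⟨⟨l.1 + 1, h⟩, by rw [succ_nsmul, succ_nsmul, hl]⟩
      · have hlm : l.1 = m := by omega
        refine ⟨⟨1, by omega⟩, ?_⟩
        rw [succ_nsmul _ k, ← hl, hlm, ← succ_nsmul, hx, one_nsmul]
  refine Finite.of_surjective (fun l : Fin (m + 1) => (⟨l.1 • x, l.1, rfl⟩ :
    AddSubmonoid.multiples x)) ?_
  rintro ⟨_, k, rfl⟩
  obtain ⟨l, hl⟩ := key k
  exact ⟨l, Subtype.ext hl⟩

/-- A factorization of the inclusion of a submonoid through a finite sum of cyclic monoids. -/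
structure Factorization (N : AddSubmonoid M) where
  /-- The index set of the sum. -/
  S : Type
  /-- The index set is finite. -/
  fintype : Fintype S
  /-- The orders of the summands. -/
  n : S → ℕ
  pos : ∀ s, 0 < n s
  /-- The map into the sum. -/
  α : N →+ ∀ s, WithZero (ZMod (n s))
  /-- The map out of the sum. -/
  β : (∀ s, WithZero (ZMod (n s))) →+ M
  comp_eq : ∀ x, β (α x) = x.1

namespace Factorization

variable {N : AddSubmonoid M}

theorem finite_mrange (F : Factorization N) : Finite (AddMonoidHom.mrange F.β) := by
  have := F.fintype
  have : ∀ s, NeZero (F.n s) := fun s => ⟨(F.pos s).ne'⟩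
  have : ∀ s, Finite (WithZero (ZMod (F.n s))) := fun s =>
    inferInstanceAs (Finite (Option (ZMod (F.n s))))
  exact Finite.of_surjective _ F.β.mrangeRestrict_surjective

theorem isFiniteSumOfCyclic (F : Factorization N) :
    IsFiniteSumOfCyclic (∀ s, WithZero (ZMod (F.n s))) := by
  have := F.fintype
  let σ := Fintype.equivFin F.S
  exact ⟨Fintype.card F.S, fun j => F.n (σ.symm j), fun j => F.pos _,
    ⟨{ Equiv.piCongrLeft' (fun s => WithZero (ZMod (F.n s))) σ with
      map_add' := fun _ _ => rfl }⟩⟩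

end Factorization

/-- The indices of a direct system with limit `M`: finite submonoids, with a level that makes the
order directed without maximal elements. -/
structure Stage (M : Type u) [AddCommMonoid M] : Type (max u v) where
  /-- The underlying submonoid. -/
  carrier : AddSubmonoid M
  finite : Finite carrier
  /-- The level. -/
  level : ULift.{v} ℕ

namespace Stage

variable (F : ∀ N : AddSubmonoid M, Finite N → Factorization N)

/-- The factorization chosen at a stage. -/
def fac (i : Stage.{u, v} M) : Factorization i.carrier := F i.carrier i.finite

/-- The strict order on the stages. -/
def Below (i j : Stage.{u, v} M) : Prop :=
  AddMonoidHom.mrange (i.fac F).β ≤ j.carrier ∧ i.level.down < j.level.down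

variable {F} in
theorem Below.ne {i j : Stage.{u, v} M} (h : Below F i j) : i ≠ j := by
  rintro rfl
  exact lt_irrefl _ h.2

theorem carrier_le_mrange (i : Stage.{u, v} M) :
    i.carrier ≤ AddMonoidHom.mrange (i.fac F).β :=
  fun x hx => ⟨(i.fac F).α ⟨x, hx⟩, (i.fac F).comp_eq _⟩

variable {F} in
theorem Below.trans {i j k : Stage.{u, v} M} (h : Below F i j) (h' : Below F j k) : Below F i k :=
  ⟨(h.1.trans (carrier_le_mrange F j)).trans h'.1, h.2.trans h'.2⟩

/-- The order on the stages. -/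
abbrev order : PartialOrder (Stage.{u, v} M) where
  le i j := i = j ∨ Below F i j
  le_refl i := Or.inl rfl
  le_trans i j k h h' := by
    rcases h with rfl | h
    · exact h'
    · rcases h' with rfl | h'
      · exact Or.inr h
      · exact Or.inr (h.trans h')
  le_antisymm i j h h' := by
    rcases h with rfl | h
    · rfl
    · rcases h' with rfl | h'
      · rfl
      · exact ((h.trans h').ne rfl).elim

/-- The monoid at a stage. -/
abbrev obj (i : Stage.{u, v} M) : Type := ∀ s, WithZero (ZMod ((i.fac F).n s))

open Classical in
/-- The transition maps. -/
noncomputable def trans (i j : Stage.{u, v} M) (h : i = j ∨ Below F i j) : obj F i →+ obj F j :=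
  if e : i = j then e ▸ AddMonoidHom.id (obj F i)
  else (j.fac F).α.comp ((i.fac F).β.codRestrict j.carrier
    fun x => (h.resolve_left e).1 ⟨x, rfl⟩)

theorem trans_self (i : Stage.{u, v} M) (h) (x : obj F i) : trans F i i h x = x := by
  simp [trans]

theorem trans_of_below {i j : Stage.{u, v} M} (h : Below F i j) (h') (x : obj F i) :
    trans F i j h' x = (j.fac F).α ⟨(i.fac F).β x, h.1 ⟨x, rfl⟩⟩ := by
  rw [trans, dif_neg h.ne]
  rfl

theorem β_trans {i j : Stage.{u, v} M} (h) (x : obj F i) :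
    (j.fac F).β (trans F i j h x) = (i.fac F).β x := by
  rcases id h with rfl | h'
  · rw [trans_self]
  · rw [trans_of_below F h', (j.fac F).comp_eq]

theorem directedSystem :
    letI := order.{u, v} F
    DirectedSystem (obj F) (fun i j (h : i ≤ j) => trans.{u, v} F i j h) := by
  let := order.{u, v} F
  refine ⟨fun i x => trans_self F i _ x, fun k j i hij hjk x => ?_⟩
  rcases id hij with rfl | hij'
  · rw [trans_self]
  · rcases id hjk with rfl | hjk'
    · rw [trans_self]
    · rw [trans_of_below F hjk', trans_of_below F (hij'.trans hjk')]
      congr 2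
      exact β_trans F hij x

theorem isDirected : letI := order.{u, v} F; IsDirectedOrder (Stage.{u, v} M) := by
  let := order.{u, v} F
  refine ⟨fun i j => ⟨⟨AddMonoidHom.mrange (i.fac F).β ⊔ AddMonoidHom.mrange (j.fac F).β,
    finite_sup (i.fac F).finite_mrange (j.fac F).finite_mrange,
    ⟨max i.level.down j.level.down + 1⟩⟩, Or.inr ⟨le_sup_left, ?_⟩, Or.inr ⟨le_sup_right, ?_⟩⟩⟩
  · exact Nat.lt_succ_of_le (le_max_left _ _)
  · exact Nat.lt_succ_of_le (le_max_right _ _)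

end Stage

theorem isLimitOfCyclicSums_of_factorization (hper : IsStronglyPeriodic M)
    (hF : ∀ N : AddSubmonoid M, Finite N → Nonempty (Factorization N)) :
    IsLimitOfCyclicSums.{u, max u v} M := by
  obtain ⟨F⟩ : Nonempty (∀ N : AddSubmonoid M, Finite N → Factorization N) :=
    ⟨fun N hN => (hF N hN).some⟩
  let := Stage.order.{u, v} F
  have hdir := Stage.isDirected.{u, v} F
  have hsys := Stage.directedSystem.{u, v} F
  have hne : Nonempty (Stage.{u, v} M) := ⟨⟨_, hper.finite_multiples 0, ⟨0⟩⟩⟩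
  refine ⟨Stage.{u, v} M, inferInstance, hdir, hne, Stage.obj F, inferInstance,
    Stage.trans F, hsys, fun i => (i.fac F).isFiniteSumOfCyclic, ⟨AddEquiv.symm ?_⟩⟩
  let g : DirectLimit (Stage.obj F) (Stage.trans F) →+ M :=
    { toFun := DirectLimit.lift (Stage.trans F) (fun i x => (i.fac F).β x)
        fun i j h x => (Stage.β_trans F h x).symm
      map_zero' := by
        rw [DirectLimit.zero_def hne.some, DirectLimit.lift_def]
        exact map_zero _
      map_add' := DirectLimit.induction₂ _ fun i x y => by
        rw [DirectLimit.add_def]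
        simp only [DirectLimit.lift_def]
        exact map_add _ _ _ }
  refine AddEquiv.ofBijective g ⟨fun p q hpq => ?_, fun x => ?_⟩
  · obtain ⟨i, x, y, rfl, rfl⟩ := DirectLimit.exists_eq_mk₂ (Stage.trans F) p q
    have hxy : (i.fac F).β x = (i.fac F).β y := hpq
    let j : Stage.{u, v} M := ⟨AddMonoidHom.mrange (i.fac F).β, (i.fac F).finite_mrange,
      ⟨i.level.down + 1⟩⟩
    have hij : Stage.Below F i j := ⟨le_rfl, Nat.lt_succ_self _⟩
    have hle : i ≤ j := Or.inr hij
    rw [DirectLimit.eq_of_le ⟨i, x⟩ j hle, DirectLimit.eq_of_le ⟨i, y⟩ j hle]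
    congr 2
    dsimp only
    rw [Stage.trans_of_below F hij, Stage.trans_of_below F hij]
    congr 2
  · let i : Stage.{u, v} M := ⟨AddSubmonoid.multiples x, hper.finite_multiples x, ⟨0⟩⟩
    exact ⟨⟦⟨i, (i.fac F).α ⟨x, AddSubmonoid.mem_multiples x⟩⟩⟧, (i.fac F).comp_eq _⟩

end Limit

section Necessity

/-- The elementary properties of finite sums of monoids `(ℤ/nℤ) ⊔ {0}` that pass to limits. -/
structure IsPureRefinement (M : Type u) [AddCommMonoid M] : Prop where
  periodic : IsStronglyPeriodic M
  conical : IsConical M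
  refinement : IsRefinementMonoid M
  inj : ∀ e f x y x' y' : M, e + e = e → e + f = f → f + f = f → e + x = x → x' + x = e →
    e + y = y → y' + y = e → x + f = y + f → x = y
  pure : ∀ n : ℕ, 0 < n → ∀ e f x y x' y' : M, e + e = e → e + f = f → f + f = f → e + x = x →
    x' + x = e → f + y = y → y' + y = f → n • y = x + f →
      ∃ z z' : M, e + z = z ∧ z' + z = e ∧ n • (z + f) = n • y

theorem IsPureRefinement.withZero (A : Type u) [AddCommGroup A] [Finite A] :
    IsPureRefinement (WithZero A) := by
  have hcases : ∀ x : WithZero A, x = 0 ∨ ∃ a : A, x = a := fun x => by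
    rcases x with _ | a
    · exact Or.inl rfl
    · exact Or.inr ⟨a, rfl⟩
  have hcon : IsConical (WithZero A) := by
    intro x y h
    obtain rfl | ⟨a, rfl⟩ := hcases x
    · exact ⟨rfl, by rwa [zero_add] at h⟩
    · obtain rfl | ⟨b, rfl⟩ := hcases y
      · rw [add_zero] at h
        exact (WithZero.coe_ne_zero h).elim
      · rw [← WithZero.coe_add] at h
        exact (WithZero.coe_ne_zero h).elim
  have hidem : ∀ e : WithZero A, e + e = e → e = 0 ∨ e = ((0 : A) : WithZero A) := by
    intro e he
    obtain rfl | ⟨a, rfl⟩ := hcases e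
    · exact Or.inl rfl
    · rw [← WithZero.coe_add, WithZero.coe_inj] at he
      exact Or.inr (congrArg _ (by simpa using he))
  have hef : ∀ f : WithZero A, f + f = f → ((0 : A) : WithZero A) + f = f →
      f = ((0 : A) : WithZero A) := by
    intro f hf h
    rcases hidem f hf with rfl | rfl
    · rw [add_zero] at h
      exact (WithZero.coe_ne_zero h).elim
    · rfl
  refine ⟨fun x => ?_, hcon, fun x₁ x₂ y₁ y₂ h => ?_, ?_, ?_⟩
  · obtain rfl | ⟨a, rfl⟩ := hcases x
    · exact ⟨1, one_pos, by simp⟩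
    · refine ⟨addOrderOf a, addOrderOf_pos a, ?_⟩
      have h1 : ∀ k : ℕ, (k + 1) • (a : WithZero A) = (((k + 1) • a : A) : WithZero A) := by
        intro k
        induction k with
        | zero => simp
        | succ k ih => rw [succ_nsmul, ih, ← WithZero.coe_add, ← succ_nsmul]
      rw [h1, succ_nsmul, addOrderOf_nsmul_eq_zero, zero_add]
  · obtain rfl | ⟨a₁, rfl⟩ := hcases x₁
    · exact ⟨0, 0, y₁, y₂, by simp, by simpa using h, by simp, by simp⟩
    obtain rfl | ⟨a₂, rfl⟩ := hcases x₂
    · exact ⟨y₁, y₂, 0, 0, by simpa using h, by simp, by simp, by simp⟩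
    obtain rfl | ⟨b₁, rfl⟩ := hcases y₁
    · exact ⟨0, a₁, 0, a₂, by simp, by simp, by simp, by simpa using h.symm⟩
    obtain rfl | ⟨b₂, rfl⟩ := hcases y₂
    · exact ⟨a₁, 0, a₂, 0, by simp, by simp, by simpa using h.symm, by simp⟩
    simp only [← WithZero.coe_add, WithZero.coe_inj] at h
    refine ⟨a₁, ((0 : A) : WithZero A), ((b₁ - a₁ : A) : WithZero A), b₂, ?_⟩
    simp only [← WithZero.coe_add, WithZero.coe_inj, add_zero, zero_add, add_sub_cancel, and_self,
      true_and, and_true]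
    rw [sub_add_eq_add_sub, ← h, add_sub_cancel_left]
  · intro e f x y x' y' he hef' hf hex hx' hey hy' h
    rcases hidem e he with rfl | rfl
    · rw [(hcon _ _ hx').2, (hcon _ _ hy').2]
    · rw [hef f hf hef', add_comm x, add_comm y, hex, hey] at h
      exact h
  · intro n hn e f x y x' y' he hef' hf hex hx' hfy hy' h
    rcases hidem e he with rfl | rfl
    · refine ⟨0, 0, by simp, by simp, ?_⟩
      rw [h, (hcon _ _ hx').2, zero_add]
      obtain ⟨k, rfl⟩ := Nat.exists_eq_succ_of_ne_zero hn.ne'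
      clear hn h
      induction k with
      | zero => simp
      | succ k ih => rw [Nat.succ_eq_add_one, succ_nsmul, ih, hf]
    · obtain rfl := hef f hf hef'
      exact ⟨y, y', hfy, hy', by rw [add_comm y, hfy]⟩

theorem IsPureRefinement.pi {S : Type v} [Fintype S] {A : S → Type u} [∀ s, AddCommMonoid (A s)]
    (h : ∀ s, IsPureRefinement (A s)) : IsPureRefinement (∀ s, A s) := by
  refine ⟨fun x => ?_, fun x y hxy => ?_, fun x₁ x₂ y₁ y₂ hxy => ?_, ?_, ?_⟩
  · choose m hm hx using fun s => (h s).periodic (x s)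
    refine ⟨∏ s, m s, Finset.prod_pos fun s _ => hm s, funext fun s => ?_⟩
    obtain ⟨k, hk⟩ := Finset.dvd_prod_of_mem m (Finset.mem_univ s)
    rw [hk, Pi.smul_apply]
    clear hk
    induction k with
    | zero => simp
    | succ k ih => rw [mul_add, mul_one, add_assoc, add_nsmul, hx, ← succ_nsmul, ih]
  · exact ⟨funext fun s => ((h s).conical _ _ (congrFun hxy s)).1,
      funext fun s => ((h s).conical _ _ (congrFun hxy s)).2⟩
  · choose a b c d h1 h2 h3 h4 using fun s => (h s).refinement _ _ _ _ (congrFun hxy s)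
    exact ⟨a, b, c, d, funext h1, funext h2, funext h3, funext h4⟩
  · intro e f x y x' y' h1 h2 h3 h4 h5 h6 h7 h8
    exact funext fun s => (h s).inj _ _ _ _ _ _ (congrFun h1 s) (congrFun h2 s) (congrFun h3 s)
      (congrFun h4 s) (congrFun h5 s) (congrFun h6 s) (congrFun h7 s) (congrFun h8 s)
  · intro n hn e f x y x' y' h1 h2 h3 h4 h5 h6 h7 h8
    choose z z' hz hz' hzn using fun s => (h s).pure n hn _ _ _ _ _ _ (congrFun h1 s)
      (congrFun h2 s) (congrFun h3 s) (congrFun h4 s) (congrFun h5 s) (congrFun h6 s)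
      (congrFun h7 s) (congrFun h8 s)
    exact ⟨z, z', funext hz, funext hz', funext hzn⟩

/-- The elementary properties pass to a monoid `M` in which finitely many elements and relations
can be lifted along homomorphisms from monoids that have them. -/
theorem IsPureRefinement.of_lift {M : Type u} [AddCommMonoid M]
    (h : ∀ (k : ℕ) (v : Fin k → M) (R : Finset ((Fin k → ℕ) × (Fin k → ℕ))),
      (∀ r ∈ R, ∑ t, r.1 t • v t = ∑ t, r.2 t • v t) →
      ∃ (B : Type v) (_ : AddCommMonoid B) (π : B →+ M) (w : Fin k → B), IsPureRefinement B ∧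
        (∀ t, π (w t) = v t) ∧ ∀ r ∈ R, ∑ t, r.1 t • w t = ∑ t, r.2 t • w t) :
    IsPureRefinement M := by
  classical
  refine ⟨fun x => ?_, fun x y hxy => ?_, fun x₁ x₂ y₁ y₂ hxy => ?_, ?_, ?_⟩
  · obtain ⟨B, _, π, w, hB, hw, -⟩ := h 1 ![x] ∅ (by simp)
    obtain ⟨m, hm, hx⟩ := hB.periodic (w 0)
    refine ⟨m, hm, ?_⟩
    rw [← show π (w 0) = x from hw 0, ← map_nsmul, hx]
  · obtain ⟨B, _, π, w, hB, hw, hR⟩ := h 2 ![x, y] {(![1, 1], 0)} (by simpa using hxy)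
    obtain ⟨h1, h2⟩ := hB.conical (w 0) (w 1) (by simpa using hR)
    rw [← show π (w 0) = x from hw 0, ← show π (w 1) = y from hw 1, h1, h2]
    simp
  · obtain ⟨B, _, π, w, hB, hw, hR⟩ := h 4 ![x₁, x₂, y₁, y₂] {(![1, 1, 0, 0], ![0, 0, 1, 1])}
      (by simpa [Fin.sum_univ_succ] using hxy)
    obtain ⟨a, b, c, d, h1, h2, h3, h4⟩ := hB.refinement (w 0) (w 1) (w 2) (w 3)
      (by simpa [Fin.sum_univ_four] using hR)
    refine ⟨π a, π b, π c, π d, ?_, ?_, ?_, ?_⟩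
    · rw [← map_add, ← h1]; exact (hw 0).symm
    · rw [← map_add, ← h2]; exact (hw 1).symm
    · rw [← map_add, ← h3]; exact (hw 2).symm
    · rw [← map_add, ← h4]; exact (hw 3).symm
  · intro e f x y x' y' h1 h2 h3 h4 h5 h6 h7 h8
    obtain ⟨B, _, π, w, hB, hw, hR⟩ := h 6 ![e, f, x, y, x', y']
      {(![2, 0, 0, 0, 0, 0], ![1, 0, 0, 0, 0, 0]), (![1, 1, 0, 0, 0, 0], ![0, 1, 0, 0, 0, 0]),
        (![0, 2, 0, 0, 0, 0], ![0, 1, 0, 0, 0, 0]), (![1, 0, 1, 0, 0, 0], ![0, 0, 1, 0, 0, 0]),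
        (![0, 0, 1, 0, 1, 0], ![1, 0, 0, 0, 0, 0]), (![1, 0, 0, 1, 0, 0], ![0, 0, 0, 1, 0, 0]),
        (![0, 0, 0, 1, 0, 1], ![1, 0, 0, 0, 0, 0]), (![0, 1, 1, 0, 0, 0], ![0, 1, 0, 1, 0, 0])}
      (by
        simp [Fin.sum_univ_six, two_nsmul, h1, h2, h3, h4, h6]
        exact ⟨by rw [add_comm, h5], by rw [add_comm, h7], by rw [add_comm, h8, add_comm]⟩)
    simp [Fin.sum_univ_six, two_nsmul] at hR
    obtain ⟨r1, r2, r3, r4, r5, r6, r7, r8⟩ := hR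
    have := hB.inj (w 0) (w 1) (w 2) (w 3) (w 4) (w 5) r1 r2 r3 r4 (by rw [add_comm, r5]) r6
      (by rw [add_comm, r7]) (by rw [add_comm, r8, add_comm])
    rw [← show π (w 2) = x from hw 2, ← show π (w 3) = y from hw 3, this]
  · intro n hn e f x y x' y' h1 h2 h3 h4 h5 h6 h7 h8
    obtain ⟨B, _, π, w, hB, hw, hR⟩ := h 6 ![e, f, x, y, x', y']
      {(![2, 0, 0, 0, 0, 0], ![1, 0, 0, 0, 0, 0]), (![1, 1, 0, 0, 0, 0], ![0, 1, 0, 0, 0, 0]),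
        (![0, 2, 0, 0, 0, 0], ![0, 1, 0, 0, 0, 0]), (![1, 0, 1, 0, 0, 0], ![0, 0, 1, 0, 0, 0]),
        (![0, 0, 1, 0, 1, 0], ![1, 0, 0, 0, 0, 0]), (![0, 1, 0, 1, 0, 0], ![0, 0, 0, 1, 0, 0]),
        (![0, 0, 0, 1, 0, 1], ![0, 1, 0, 0, 0, 0]), (![0, 0, 0, n, 0, 0], ![0, 1, 1, 0, 0, 0])}
      (by
        simp [Fin.sum_univ_six, two_nsmul, h1, h2, h3, h4, h6]
        exact ⟨by rw [add_comm, h5], by rw [add_comm, h7], by rw [h8, add_comm]⟩)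
    simp [Fin.sum_univ_six, two_nsmul] at hR
    obtain ⟨r1, r2, r3, r4, r5, r6, r7, r8⟩ := hR
    obtain ⟨z, z', hz, hz', hzn⟩ := hB.pure n hn (w 0) (w 1) (w 2) (w 3) (w 4) (w 5) r1 r2 r3 r4
      (by rw [add_comm, r5]) r6 (by rw [add_comm, r7]) (by rw [r8, add_comm])
    refine ⟨π z, π z', ?_, ?_, ?_⟩
    · rw [← show π (w 0) = e from hw 0, ← map_add, hz]
    · rw [← show π (w 0) = e from hw 0, ← map_add, hz']
    · rw [← show π (w 1) = f from hw 1, ← show π (w 3) = y from hw 3, ← map_add, ← map_nsmul, hzn,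
        map_nsmul]

theorem IsPureRefinement.of_addEquiv {M : Type u} {B : Type v} [AddCommMonoid M] [AddCommMonoid B]
    (hB : IsPureRefinement B) (e : B ≃+ M) : IsPureRefinement M := by
  refine IsPureRefinement.of_lift fun k v R hR => ⟨B, inferInstance, e.toAddMonoidHom,
    fun t => e.symm (v t), hB, fun t => e.apply_symm_apply _, fun r hr => ?_⟩
  simp only [← map_nsmul, ← map_sum, hR r hr]

theorem IsFiniteSumOfCyclic.isPureRefinement {B : Type} [AddCommMonoid B]
    (h : IsFiniteSumOfCyclic B) : IsPureRefinement B := by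
  obtain ⟨k, n, hn, ⟨e⟩⟩ := h
  have : ∀ j, NeZero (n j) := fun j => ⟨(hn j).ne'⟩
  exact (IsPureRefinement.pi fun j => IsPureRefinement.withZero (ZMod (n j))).of_addEquiv e.symm

theorem IsPureRefinement.directLimit {ι : Type w} [PartialOrder ι] [IsDirectedOrder ι] [Nonempty ι]
    (B : ι → Type v) [∀ i, AddCommMonoid (B i)] (φ : ∀ i j, i ≤ j → B i →+ B j)
    [DirectedSystem B (φ · · ·)] (hB : ∀ i, IsPureRefinement (B i)) :
    IsPureRefinement (DirectLimit B φ) := by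
  classical
  let π : ∀ i, B i →+ DirectLimit B φ := fun i =>
    { toFun := fun x => ⟦⟨i, x⟩⟧
      map_zero' := (DirectLimit.zero_def i).symm
      map_add' := fun x y => (DirectLimit.add_def i x y).symm }
  have hπ : ∀ i j h x, π j (φ i j h x) = π i x := fun i j h x =>
    (DirectLimit.eq_of_le ⟨i, x⟩ j h).symm
  have hex : ∀ x, ∃ i y, π i y = x := fun x => by
    obtain ⟨i, y, rfl⟩ := DirectLimit.exists_eq_mk φ x
    exact ⟨i, y, rfl⟩
  have heq : ∀ i x y, π i x = π i y → ∃ j h, φ i j h x = φ i j h y := by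
    intro i x y hxy
    obtain ⟨j, h, h', hj⟩ := Quotient.exact hxy
    exact ⟨j, h, hj⟩
  refine IsPureRefinement.of_lift fun k v R hR => ?_
  choose i₀ y hy using fun t => hex (v t)
  obtain ⟨i, hi⟩ := Finite.exists_le i₀
  let w : Fin k → B i := fun t => φ _ _ (hi t) (y t)
  have hw : ∀ t, π i (w t) = v t := fun t => (hπ _ _ _ _).trans (hy t)
  have key : ∃ j h, ∀ r ∈ R, φ i j h (∑ t, r.1 t • w t) = φ i j h (∑ t, r.2 t • w t) := by
    induction R using Finset.induction_on with
    | empty => exact ⟨i, le_rfl, by simp⟩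
    | insert r R _ ih =>
      obtain ⟨j, hj, hjR⟩ := ih fun r hr => hR r (Finset.mem_insert_of_mem hr)
      obtain ⟨j', hj', hr⟩ := heq i (∑ t, r.1 t • w t) (∑ t, r.2 t • w t) (by
        simp only [map_sum, map_nsmul, hw]
        exact hR r (Finset.mem_insert_self _ _))
      obtain ⟨l, hl, hl'⟩ := exists_ge_ge j j'
      have hcomp : ∀ a (ha : i ≤ a) (hal : a ≤ l) z, φ i l (ha.trans hal) z = φ a l hal (φ i a ha z) :=
        fun a ha hal z => (DirectedSystem.map_map' φ ha hal z).symm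
      refine ⟨l, hj.trans hl, fun r' hr' => ?_⟩
      rcases Finset.mem_insert.1 hr' with rfl | hr'
      · rw [hcomp j' hj' hl', hr, hcomp j' hj' hl']
      · rw [hcomp j hj hl, hjR r' hr', hcomp j hj hl]
  obtain ⟨j, hj, hjR⟩ := key
  refine ⟨B j, inferInstance, π j, fun t => φ i j hj (w t), hB j, fun t => ?_, fun r hr => ?_⟩
  · rw [hπ, hw]
  · simpa only [map_sum, map_nsmul] using hjR r hr

variable {M : Type u} [AddCommMonoid M]

theorem IsPureRefinement.shift_injective (hM : IsPureRefinement M) {e f : Idem M}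
    (h : AlgLE e.1 f.1) : Function.Injective (Component.shift h) := by
  intro x y hxy
  obtain ⟨x', hx'⟩ := Component.exists_neg x
  obtain ⟨y', hy'⟩ := Component.exists_neg y
  exact Subtype.ext (hM.inj e.1 f.1 x.1 y.1 x'.1 y'.1 e.2 (by rw [add_comm, h.add_eq e.2]) f.2 (Component.idem_add x)
    hx' (Component.idem_add y) hy' (congrArg Subtype.val hxy))

theorem Component.nsmul_val_of_pos {e : Idem M} (x : Component e) {n : ℕ} (hn : 0 < n) :
    (n • x).1 = n • x.1 := by
  have h := Component.nsmul_val x n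
  rw [add_comm, Component.idem_add] at h
  rw [h]
  obtain ⟨k, rfl⟩ := Nat.exists_eq_succ_of_ne_zero hn.ne'
  rw [Nat.succ_eq_add_one, succ_nsmul, add_assoc, add_comm x.1, Component.idem_add]

theorem IsPureRefinement.shift_pure (hM : IsPureRefinement M) {e f : Idem M}
    (h : AlgLE e.1 f.1) : IsPure (Component.shift h).range := by
  rintro n y ⟨x, hx⟩
  rcases Nat.eq_zero_or_pos n with rfl | hn
  · exact ⟨0, zero_mem _, by simp⟩
  obtain ⟨x', hx'⟩ := Component.exists_neg x
  obtain ⟨y', hy'⟩ := Component.exists_neg y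
  have hval := congrArg Subtype.val hx
  rw [Component.nsmul_val_of_pos y hn] at hval
  obtain ⟨z, z', hz, hz', hzn⟩ := hM.pure n hn e.1 f.1 x.1 y.1 x'.1 y'.1 e.2 (by rw [add_comm, h.add_eq e.2]) f.2
    (Component.idem_add x) hx' (Component.idem_add y) hy' hval.symm
  refine ⟨_, ⟨⟨z, ⟨z, hz⟩, ⟨z', by rw [add_comm, hz']⟩⟩, rfl⟩, Subtype.ext ?_⟩
  rw [Component.nsmul_val_of_pos _ hn, Component.nsmul_val_of_pos _ hn]
  exact hzn

end Necessity

end LimitsOfCyclicMonoids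

open LimitsOfCyclicMonoids
theorem theorem5p3 (M : Type u) [AddCommMonoid M] :
    IsLimitOfCyclicSums.{u, max u v} M ↔
      (IsStronglyPeriodic M ∧ IsConical M ∧ IsRefinementMonoid M) ∧
      ∀ (e f : Idem M) (h : AlgLE e.1 f.1),
        Function.Injective (Component.shift h) ∧ IsPure (Component.shift h).range := by
  constructor
  · rintro ⟨ι, _, _, _, B, _, φ, _, hB, ⟨g⟩⟩
    have hM : IsPureRefinement M :=
      (IsPureRefinement.directLimit B φ fun i => (hB i).isPureRefinement).of_addEquiv g.symm
    exact ⟨⟨hM.periodic, hM.conical, hM.refinement⟩,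
      fun e f h => ⟨hM.shift_injective h, hM.shift_pure h⟩⟩
  · rintro ⟨⟨hper, hcon, href⟩, hb⟩
    have hemb := isGroupEmbedded hper fun e f h => (hb e f h).1
    have hpure := isGroupPure hper hemb fun e f h => (hb e f h).2
    refine isLimitOfCyclicSums_of_factorization.{u, v} hper fun N _ => ?_
    obtain ⟨S, hS, n, hn, α, β, h⟩ := exists_factorization hper hcon href hemb hpure N
    exact ⟨⟨S, hS, n, hn, α, β, h⟩⟩
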